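/- Let $X$ be a real Hilbert space, and let $T\colon X\rightrightarrows X$ be a set-valued mapping whose graph $\operatorname{gph}T=\{(u,v)\in X\times X : v\in T(u)\}$ is closed in the norm topology of $X\times X$ and whose domain $\operatorname{dom}T=\{u\in X: T(u)\neq\emptyset\}$ is nonempty and convex. Then the following assertions are equivalent. (i) $T$ is maximal monotone on $X$, i.e. $\langle v_1-v_2,u_1-u_2\rangle\ge 0$ for all $(u_1,v_1),(u_2,v_2)\in\operatorname{gph}T$, and $\operatorname{gph}T=\operatorname{gph}S$ for every $S\colon X\rightrightarrows X$ that is monotone in this sense and satisfies $\operatorname{gph}T\subset\operatorname{gph}S$. (ii) $T$ is semilocally hypomonotone on $X$, i.e. for every $\bar u\in\operatorname{dom}T$ there exist a neighborhood $U$ of $\bar u$ and a number $r>0$ such that $$\langle v_1-v_2,u_1-u_2\rangle\ge -r\|u_1-u_2\|^2\quad\text{for all }(u_1,v_1),(u_2,v_2)\in\operatorname{gph}T\cap(U\times X),$$ and for every $(u,v)\in\operatorname{gph}T$ and every $w\in X$ one has $$\langle z,w\rangle\ge 0\quad\text{whenever } z\in\widehat D^*T(u,v)(w).$$ Here $\widehat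 D^*T(u,v)(w)=\{z\in X : (z,-w)\in\widehat N((u,v);\operatorname{gph}T)\}$ is the regular coderivative, where the regular normal cone $\widehat N(x;\Omega)$ to a subset $\Omega$ of a Hilbert space $E$ at $x\in\Omega$ is the regular (Fréchet) subdifferential at $x$ of the indicator function $\delta(\cdot;\Omega)$ (equal to $0$ on $\Omega$ and to $\infty$ off $\Omega$), and the regular subdifferential of $f\colon E\to\mathbb R\cup\{\infty\}$ at a point $x$ with $f(x)<\infty$ is $$\widehat\partial f(x)=\Big\{p\in E : \liminf_{u\to x,\ u\ne x}\frac{f(u)-f(x)-\langle p,u-x\rangle}{\|u-x\|}\ge 0\Big\}$$ (with the convention that the limit inferior at an isolated point is $+\infty$). The space $E=X\times X$ carries the inner product $\langle (a,b),(c,d)\rangle=\langle a,c\rangle+\langle b,d\rangle$. -/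

import Mathlib

open Filter Topology

noncomputable section

namespace SetValued

section VariationalAnalysis

variable {E : Type*} [NormedAddCommGroup E] [InnerProductSpace ℝ E]

/-- The regular (Fréchet) subdifferential of an extended-real-valued function `f` at `x`:
the vectors `v` with
`liminf_{u → x, u ≠ x} (f u - f x - ⟪v, u - x⟫) / ‖u - x‖ ≥ 0`; it is empty when `f x = ∞`. -/
def regularSubdifferential (f : E → EReal) (x : E) : Set E :=
  {v | f x < ⊤ ∧
    0 ≤ liminf (fun u => (f u - f x - ((inner ℝ v (u - x) : ℝ) : EReal)) / ((‖u - x‖ : ℝ) : EReal))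
      (𝓝[≠] x)}

open Classical in
/-- The indicator function `δ(·; Ω)`: zero on `Ω` and `∞` elsewhere. -/
def indicatorFn (Ω : Set E) (u : E) : EReal := if u ∈ Ω then 0 else ⊤

/-- The regular (Fréchet) normal cone to `Ω` at `x`. -/
def regularNormalCone (Ω : Set E) (x : E) : Set E :=
  regularSubdifferential (indicatorFn Ω) x

end VariationalAnalysis

section Mappings

variable {X : Type*}

/-- The domain of a set-valued mapping. -/
def dom (T : X → Set X) : Set X := {u | (T u).Nonempty}

/-- The graph of a set-valued mapping. -/
def gph (T : X → Set X) : Set (X × X) := {p | p.2 ∈ T p.1}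

variable [NormedAddCommGroup X] [InnerProductSpace ℝ X]

/-- The regular coderivative of `T` at `(u, v)` applied to `w`: the vectors `z` with
`(z, -w)` in the regular normal cone to the graph of `T` at `(u, v)`. The normal cone is taken
in the Hilbert product `WithLp 2 (X × X)`, since the norm of the plain product `X × X` in
Mathlib does not come from an inner product. -/
def regularCoderivative (T : X → Set X) (u v w : X) : Set X :=
  {z | WithLp.toLp 2 (z, -w) ∈
    regularNormalCone (E := WithLp 2 (X × X)) (WithLp.ofLp ⁻¹' gph T) (WithLp.toLp 2 (u, v))}

/-- The positive-semidefiniteness condition for the regular coderivative. -/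
def RegularCoderivativePSD (T : X → Set X) : Prop :=
  ∀ u v, (u, v) ∈ gph T → ∀ w, ∀ z ∈ regularCoderivative T u v w, 0 ≤ inner ℝ z w

/-- Monotonicity of a set-valued mapping. -/
def IsMonotone (T : X → Set X) : Prop :=
  ∀ u₁ v₁ u₂ v₂, (u₁, v₁) ∈ gph T → (u₂, v₂) ∈ gph T → 0 ≤ inner ℝ (v₁ - v₂) (u₁ - u₂)

/-- Maximal monotonicity of a set-valued mapping. -/
def IsMaximalMonotone (T : X → Set X) : Prop :=
  IsMonotone T ∧ ∀ S : X → Set X, IsMonotone S → gph T ⊆ gph S → gph T = gph S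

/-- Semilocal hypomonotonicity at a point: the hypomonotonicity inequality holds, with some
`r > 0`, for all points of the graph whose first component lies in some neighborhood. -/
def SemilocallyHypomonotoneAt (T : X → Set X) (x : X) : Prop :=
  ∃ U ∈ 𝓝 x, ∃ r : ℝ, 0 < r ∧
    ∀ u₁ v₁ u₂ v₂, (u₁, v₁) ∈ gph T ∩ U ×ˢ Set.univ → (u₂, v₂) ∈ gph T ∩ U ×ˢ Set.univ →
      -r * ‖u₁ - u₂‖ ^ 2 ≤ inner ℝ (v₁ - v₂) (u₁ - u₂)

/-- Semilocal hypomonotonicity on a set `Ω`: at every point of `Ω` in the domain. -/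
def SemilocallyHypomonotoneOn (T : X → Set X) (Ω : Set X) : Prop :=
  ∀ x ∈ Ω ∩ dom T, SemilocallyHypomonotoneAt T x

end Mappings

end SetValued

end

namespace SetValued

/-! ### Regular normals and Fermat's rule. -/

section NormalCone

variable {E : Type*} [NormedAddCommGroup E] [InnerProductSpace ℝ E]

/-! From (i) to (ii), hypomonotonicity is immediate. For the coderivative condition, Minty's theorem
supplies graph points near `(u, v)` whose sum is `u + v + t • (z - w)`. Testing the normal `(z, -w)`
on them, with firm nonexpansiveness of the resolvent, gives `‖z - w‖ ≤ ‖z + w‖`, that is, `⟪z, w⟫ ≥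
0`.

From (ii) to (i), the coderivative condition enters only as `⟪n₁, n₂⟫ ≤ 0` for every regular normal
`(n₁, n₂)` to the graph. Closed graphs need not yield exact minimizers in infinite dimensions, but
the Borwein–Preiss principle yields approximate ones at which `-(∇f + h)` is normal with `h` small.
A function `f` whose two partial gradients have positive inner product is thus excluded. Two choices
of `f` carry the proof.

In `inner_nonneg_of_hypomonotone`, the coordinates `A = s • u + v` and `B = s • u - v` turn
monotonicity into `‖B‖ ≤ ‖A‖` for differences. A violation makes `B` grow faster than `A`, and a
linear function of `B` plus a multiple of `‖A‖` with slope above 1 detects it. The resulting local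
monotonicity spreads along segments of the convex domain.

In `IsMonotone.exists_add_near`, `f` is `‖u + v - y‖ ^ 2`. Its approximate minimizers nearly solve
`u + v = y`, so the sum map on the closed graph is onto, which forces maximality. -/

theorem mem_regularNormalCone_iff {Ω : Set E} {x p : E} :
    p ∈ regularNormalCone Ω x ↔
      x ∈ Ω ∧ ∀ ε > 0, ∀ᶠ u in 𝓝[Ω] x, inner ℝ p (u - x) ≤ ε * ‖u - x‖ := by
  classical
  unfold regularNormalCone regularSubdifferential
  rw [Set.mem_ofPred_eq]
  have hx : indicatorFn Ω x < ⊤ ↔ x ∈ Ω := by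
    unfold indicatorFn; split_ifs with h <;> simp [h]
  rw [hx]
  refine and_congr_right fun hxΩ => ?_
  have hval : ∀ u, u ≠ x → (indicatorFn Ω u - indicatorFn Ω x -
      ((inner ℝ p (u - x) : ℝ) : EReal)) / ((‖u - x‖ : ℝ) : EReal) =
      if u ∈ Ω then ((-(inner ℝ p (u - x)) / ‖u - x‖ : ℝ) : EReal) else ⊤ := by
    intro u hu
    have hpos : 0 < ‖u - x‖ := norm_pos_iff.2 (sub_ne_zero.2 hu)
    unfold indicatorFn
    rw [if_pos hxΩ]
    split_ifs with h
    · rw [EReal.coe_div]; simp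
    · rw [sub_zero, EReal.top_sub_coe, EReal.top_div_of_pos_ne_top (by exact_mod_cast hpos)
        (EReal.coe_ne_top _)]
  have hcongr := liminf_congr (f := 𝓝[≠] x) (eventually_mem_nhdsWithin.mono hval)
  rw [hcongr, le_liminf_iff]
  constructor
  · intro h ε hε
    have h1 := h ((-ε : ℝ) : EReal) (by exact_mod_cast (neg_lt_zero.2 hε))
    rw [eventually_nhdsWithin_iff] at h1 ⊢
    filter_upwards [h1] with u hu huΩ
    rcases eq_or_ne u x with rfl | hne
    · simp
    have h2 := hu hne
    rw [if_pos huΩ] at h2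
    have hpos : 0 < ‖u - x‖ := norm_pos_iff.2 (sub_ne_zero.2 hne)
    have h3 : -ε < -(inner ℝ p (u - x)) / ‖u - x‖ := by exact_mod_cast h2
    rw [lt_div_iff₀ hpos] at h3
    linarith
  · intro h y hy
    obtain ⟨q, hyq, hq⟩ := EReal.lt_iff_exists_real_btwn.1 hy
    have hq0 : q < 0 := by exact_mod_cast hq
    have h1 := h (-q / 2) (by linarith)
    rw [eventually_nhdsWithin_iff] at h1 ⊢
    filter_upwards [h1] with u hu hne
    split_ifs with hΩ
    · refine hyq.trans ?_
      have hpos : 0 < ‖u - x‖ := norm_pos_iff.2 (sub_ne_zero.2 hne)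
      have h2 : q < -(inner ℝ p (u - x)) / ‖u - x‖ := by
        rw [lt_div_iff₀ hpos]
        nlinarith [hu hΩ]
      exact_mod_cast h2
    · exact lt_of_lt_of_le hyq le_top

theorem _root_.HasFDerivAt.hasGradientAt_of_inner [CompleteSpace E] {f : E → ℝ}
    {L : StrongDual ℝ E} {x g : E} (hf : HasFDerivAt f L x) (hL : ∀ y, L y = inner ℝ g y) :
    HasGradientAt f g x := by
  rw [hasGradientAt_iff_hasFDerivAt]
  rwa [show L = InnerProductSpace.toDual ℝ E g from
    ContinuousLinearMap.ext fun y => by simpa using hL y] at hf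

/-- Fermat's rule: a local minimizer of a function on a set has the negative gradient of the
function as a regular normal. -/
theorem neg_gradient_mem_regularNormalCone [CompleteSpace E] {Ω : Set E} {f : E → ℝ} {x g : E}
    (hx : x ∈ Ω) (hf : HasGradientAt f g x) (hmin : ∀ᶠ u in 𝓝[Ω] x, f x ≤ f u) :
    -g ∈ regularNormalCone Ω x := by
  refine mem_regularNormalCone_iff.2 ⟨hx, fun ε hε => ?_⟩
  have h := (hasGradientAt_iff_isLittleO.1 hf).def hε
  filter_upwards [hmin, nhdsWithin_le_nhds h] with u h1 h2
  rw [inner_neg_left]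
  have := abs_le.1 (Real.norm_eq_abs _ ▸ h2)
  linarith [this.2]

end NormalCone

/-! ### The smooth variational principle and approximate normals. -/

section VariationalPrinciple

variable {E : Type*} [NormedAddCommGroup E] [InnerProductSpace ℝ E] [CompleteSpace E]

/-- The Borwein–Preiss smooth variational principle on a bounded closed set of a Hilbert space. -/
theorem exists_quadratic_perturbation_min {C : Set E} (hC : IsClosed C) (hne : C.Nonempty)
    {R : ℝ} (hR : ∀ x ∈ C, ‖x‖ ≤ R) {f : E → ℝ} (hf : ContinuousOn f C) {m : ℝ}
    (hm : ∀ x ∈ C, m ≤ f x) {δ : ℝ} (hδ : 0 < δ) :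
    ∃ x ∈ C, ∃ a, ‖a‖ ≤ R ∧ ∀ z ∈ C, f x + δ * ‖x - a‖ ^ 2 ≤ f z + δ * ‖z - a‖ ^ 2 := by
  -- The lower bound sits inside the conclusion so that the choice is total in `g` and can be
  -- iterated before the bound is known for the perturbed functions.
  have hpick : ∀ (g : E → ℝ) (n : ℕ), ∃ x ∈ C, (∀ z ∈ C, m ≤ g z) →
      ∀ z ∈ C, g x ≤ g z + δ * (1 / 2) ^ (n + 1) * ((1 / 4) ^ n / 2) := by
    intro g n
    by_cases hg : ∀ z ∈ C, m ≤ g z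
    · have hb : BddBelow (g '' C) := ⟨m, by rintro _ ⟨z, hz, rfl⟩; exact hg z hz⟩
      have hpos : 0 < δ * (1 / 2) ^ (n + 1) * ((1 / 4) ^ n / 2) := by positivity
      obtain ⟨_, ⟨x, hx, rfl⟩, hlt⟩ :=
        exists_lt_of_csInf_lt (hne.image g) (lt_add_of_pos_right (sInf (g '' C)) hpos)
      exact ⟨x, hx, fun _ z hz => hlt.le.trans
        (by gcongr; exact csInf_le hb (Set.mem_image_of_mem g hz))⟩
    · obtain ⟨x, hx⟩ := hne
      exact ⟨x, hx, fun h => absurd h hg⟩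
  choose pick hpickC hpick using hpick
  -- Each stage adds a parabola centred at the current approximate minimizer. The tolerance shrinks
  -- faster than the weights, so consecutive centres are within `(1 / 2) ^ n`.
  let G : ℕ → E → ℝ := fun n => Nat.rec f
    (fun n g x => g x + δ * (1 / 2) ^ (n + 1) * ‖x - pick g n‖ ^ 2) n
  let x : ℕ → E := fun n => pick (G n) n
  have hG : ∀ n z, G (n + 1) z = G n z + δ * (1 / 2) ^ (n + 1) * ‖z - x n‖ ^ 2 :=
    fun n z => rfl
  have hxC : ∀ n, x n ∈ C := fun n => hpickC _ _
  have hGmono : ∀ z, Monotone fun n => G n z := fun z =>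
    monotone_nat_of_le_succ fun n => by
      rw [hG]; exact le_add_of_nonneg_right (by positivity)
  have hGm : ∀ n, ∀ z ∈ C, m ≤ G n z := fun n z hz => (hm z hz).trans (hGmono z (Nat.zero_le n))
  have hx : ∀ n, ∀ z ∈ C, G n (x n) ≤ G n z + δ * (1 / 2) ^ (n + 1) * ((1 / 4) ^ n / 2) :=
    fun n => hpick (G n) n (hGm n)
  have hstep : ∀ n, dist (x n) (x (n + 1)) ≤ 1 * (1 / 2) ^ n := by
    intro n
    have h1 := hx (n + 1) (x n) (hxC n)
    have h2 := hx n (x (n + 1)) (hxC (n + 1))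
    rw [hG, hG, sub_self, norm_zero] at h1
    have hd : (0 : ℝ) < δ * (1 / 2) ^ (n + 1) := by positivity
    have h4 : (0 : ℝ) < (1 / 4) ^ n := by positivity
    have h3 : δ * (1 / 2) ^ (n + 1) * ‖x (n + 1) - x n‖ ^ 2
        ≤ δ * (1 / 2) ^ (n + 1) * (1 / 4) ^ n := by
      have h5 : δ * (1 / 2) ^ (n + 1 + 1) * ((1 / 4) ^ (n + 1) / 2)
          = δ * (1 / 2) ^ (n + 1) * ((1 / 4) ^ n / 16) := by ring
      rw [h5] at h1
      nlinarith [mul_pos hd h4]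
    have h6 := le_of_mul_le_mul_left h3 hd
    rw [dist_comm, dist_eq_norm, one_mul]
    refine abs_le_of_sq_le_sq' ?_ (by positivity) |>.2
    calc ‖x (n + 1) - x n‖ ^ 2 ≤ (1 / 4) ^ n := h6
      _ = ((1 / 2) ^ n) ^ 2 := by rw [← pow_mul, mul_comm, pow_mul]; norm_num
  obtain ⟨y, hy⟩ := cauchySeq_tendsto_of_complete
    (cauchySeq_of_le_geometric (1 / 2) 1 (by norm_num) hstep)
  have hyC : y ∈ C := hC.mem_of_tendsto hy (Eventually.of_forall hxC)
  have hgeom : HasSum (fun n : ℕ => (1 / 2 : ℝ) ^ (n + 1)) 1 := by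
    simpa [pow_succ', div_eq_mul_inv] using hasSum_geometric_two' 1
  have hsum_a : Summable fun n => (1 / 2 : ℝ) ^ (n + 1) • x n :=
    Summable.of_norm_bounded (hgeom.summable.mul_right R) fun n => by
      rw [norm_smul, Real.norm_of_nonneg (by positivity)]
      gcongr
      exact hR _ (hxC n)
  obtain ⟨a, ha⟩ := hsum_a
  have hsum_b : Summable fun n => (1 / 2 : ℝ) ^ (n + 1) * ‖x n‖ ^ 2 :=
    Summable.of_norm_bounded (hgeom.summable.mul_right (R ^ 2)) fun n => by
      rw [Real.norm_of_nonneg (by positivity)]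
      gcongr
      exact hR _ (hxC n)
  obtain ⟨b, hb⟩ := hsum_b
  have hGsum : ∀ n z, G n z = f z + ∑ k ∈ Finset.range n, δ * (1 / 2) ^ (k + 1) * ‖z - x k‖ ^ 2 := by
    intro n z
    induction n with
    | zero => simp [G]
    | succ n ih => rw [hG, ih, Finset.sum_range_succ, add_assoc]
  -- The weights sum to 1, so the parabolas add up to a single one centred at the barycentre `a`,
  -- plus a constant that drops out of comparisons.
  have hlim : ∀ z, Tendsto (fun n => G n z) atTop
      (𝓝 (f z + δ * ‖z - a‖ ^ 2 + δ * (b - ‖a‖ ^ 2))) := by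
    intro z
    simp only [hGsum]
    rw [add_assoc]
    refine Tendsto.const_add _ ?_
    have hs : HasSum (fun k => δ * (1 / 2) ^ (k + 1) * ‖z - x k‖ ^ 2)
        (δ * (1 * ‖z‖ ^ 2 - 2 * innerSL ℝ z a + b)) := by
      have := (((hgeom.mul_right (‖z‖ ^ 2)).sub
        ((ha.mapL (innerSL ℝ z)).mul_left 2)).add hb).mul_left δ
      refine (congrArg (HasSum · _) (funext fun k => ?_)).mp this
      rw [map_smul, innerSL_apply_apply, smul_eq_mul, norm_sub_sq_real]
      ring
    convert hs.tendsto_sum_nat using 2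
    rw [norm_sub_sq_real, innerSL_apply_apply]; ring
  refine ⟨y, hyC, a, ?_, fun z hz => ?_⟩
  · have : ‖a‖ ≤ ∑' n, (1 / 2 : ℝ) ^ (n + 1) * R := by
      rw [← ha.tsum_eq]
      refine tsum_of_norm_bounded (hgeom.summable.mul_right R).hasSum fun n => ?_
      rw [norm_smul, Real.norm_of_nonneg (by positivity)]
      gcongr
      exact hR _ (hxC n)
    rwa [(hgeom.mul_right R).tsum_eq, one_mul] at this
  · suffices h : f y + δ * ‖y - a‖ ^ 2 + δ * (b - ‖a‖ ^ 2) ≤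
        f z + δ * ‖z - a‖ ^ 2 + δ * (b - ‖a‖ ^ 2) by linarith
    refine le_of_tendsto (hlim y) (Eventually.of_forall fun N => ?_)
    have hy' : Tendsto x atTop (𝓝[C] y) :=
      tendsto_nhdsWithin_iff.2 ⟨hy, Eventually.of_forall hxC⟩
    have hcont : ContinuousWithinAt (G N) C y := by
      have : G N = fun z =>
          f z + ∑ k ∈ Finset.range N, δ * (1 / 2) ^ (k + 1) * ‖z - x k‖ ^ 2 :=
        funext (hGsum N)
      rw [this]
      exact (hf y hyC).add (by fun_prop : Continuous _).continuousWithinAt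
    have hε : Tendsto (fun n : ℕ => δ * (1 / 2) ^ (n + 1) * ((1 / 4 : ℝ) ^ n / 2)) atTop (𝓝 0) := by
      have h1 := tendsto_pow_atTop_nhds_zero_of_lt_one (r := (1 / 8 : ℝ)) (by norm_num) (by norm_num)
      have h2 := h1.const_mul (δ / 4)
      rw [mul_zero] at h2
      refine h2.congr fun n => ?_
      rw [show (1 / 8 : ℝ) = 1 / 2 * (1 / 4) by norm_num, mul_pow]; ring
    have hr := hε.const_add (f z + δ * ‖z - a‖ ^ 2 + δ * (b - ‖a‖ ^ 2))
    rw [add_zero] at hr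
    refine le_of_tendsto_of_tendsto (hcont.tendsto.comp hy') hr ?_
    filter_upwards [eventually_ge_atTop N] with n hn
    calc G N (x n) ≤ G n (x n) := hGmono _ hn
      _ ≤ G n z + _ := hx n z hz
      _ ≤ _ := by gcongr; exact (hGmono z).ge_of_tendsto (hlim z) n

/-- On a bounded closed piece `C` of a set `Ω`, an approximate minimizer of `f` can be chosen so
that, if `C` is a neighborhood of it in `Ω`, a small perturbation of `-∇f` is normal to `Ω`. -/
theorem exists_approx_min_normal {Ω C : Set E} (hCΩ : C ⊆ Ω) (hC : IsClosed C) {R : ℝ}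
    (hR : ∀ x ∈ C, ‖x‖ ≤ R) {f : E → ℝ} (hf : ContinuousOn f C) {m : ℝ}
    (hm : ∀ x ∈ C, m ≤ f x) {x₀ : E} (hx₀ : x₀ ∈ C) {η : ℝ} (hη : 0 < η) :
    ∃ x ∈ C, ∃ h, ‖h‖ ≤ η ∧ f x ≤ f x₀ + η ∧
      (C ∈ 𝓝[Ω] x → ∀ g, HasGradientAt f g x → -(g + h) ∈ regularNormalCone Ω x) := by
  have hR0 : 0 ≤ R := (norm_nonneg _).trans (hR x₀ hx₀)
  -- In the denominator, `4 * R` controls the gradient `2δ(x - a)`, `4 * R ^ 2` controls the value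
  -- `δ‖x₀ - a‖ ^ 2`, and 1 covers `R = 0`.
  obtain ⟨x, hx, a, ha, hmin⟩ := exists_quadratic_perturbation_min hC ⟨x₀, hx₀⟩ hR hf hm
    (δ := η / (4 * R + 4 * R ^ 2 + 1)) (by positivity)
  set δ := η / (4 * R + 4 * R ^ 2 + 1) with hδdef
  have hδ : 0 < δ := by positivity
  have hδη : δ * (4 * R + 4 * R ^ 2 + 1) = η := by rw [hδdef]; field_simp
  have hdist : ∀ z ∈ C, ‖z - a‖ ≤ 2 * R := fun z hz => by
    linarith [norm_sub_le z a, hR z hz]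
  refine ⟨x, hx, (2 * δ) • (x - a), ?_, ?_, fun hnhds g hg => ?_⟩
  · rw [norm_smul, Real.norm_of_nonneg (by positivity)]
    nlinarith [hdist x hx, mul_nonneg hδ.le hR0, mul_nonneg hδ.le (sq_nonneg R)]
  · have h1 := hmin x₀ hx₀
    have h2 : ‖x₀ - a‖ ^ 2 ≤ (2 * R) ^ 2 := by gcongr; exact hdist x₀ hx₀
    nlinarith [mul_nonneg hδ.le (sq_nonneg ‖x - a‖), mul_nonneg hδ.le hR0,
      mul_le_mul_of_nonneg_left h2 hδ.le]
  · have hq : HasGradientAt (fun z => f z + δ * ‖z - a‖ ^ 2) (g + (2 * δ) • (x - a)) x := by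
      refine HasFDerivAt.hasGradientAt_of_inner
        (hg.hasFDerivAt.add (((hasFDerivAt_id x).sub_const a).norm_sq.const_mul δ)) fun y => ?_
      simp [inner_add_left, inner_sub_left, inner_smul_left]
      ring
    exact neg_gradient_mem_regularNormalCone (hCΩ hx) hq
      (by filter_upwards [hnhds] with z hz using hmin z hz)

end VariationalPrinciple

/-! ### The coderivative condition as a sign condition on normals. -/

section Graph

variable {X : Type*}

/-- The graph of a set-valued mapping as a subset of the Hilbert product. -/
def gphL2 (T : X → Set X) : Set (WithLp 2 (X × X)) := WithLp.ofLp ⁻¹' gph T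

theorem isClosed_gphL2 [NormedAddCommGroup X] {T : X → Set X} (h : IsClosed (gph T)) :
    IsClosed (gphL2 T) :=
  h.preimage (WithLp.prod_continuous_ofLp 2 X X)

variable [NormedAddCommGroup X] [InnerProductSpace ℝ X]

theorem RegularCoderivativePSD.inner_nonpos {T : X → Set X} (h : RegularCoderivativePSD T)
    {x n : WithLp 2 (X × X)} (hn : n ∈ regularNormalCone (gphL2 T) x) :
    inner ℝ n.fst n.snd ≤ 0 := by
  have hx : x ∈ gphL2 T := (mem_regularNormalCone_iff.1 hn).1
  have := h x.fst x.snd hx (-n.snd) n.fst (by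
    change WithLp.toLp 2 (n.fst, - -n.snd) ∈ regularNormalCone (gphL2 T) _
    rw [neg_neg]; exact hn)
  rw [inner_neg_right] at this
  linarith

/-- Unperturbed, the inner product is `s * (‖q‖ ^ 2 - 1)`. Each error term is at most a multiple of
`(1 + ‖q‖) * η`, with total factor `s + 2`, and `1 + ‖q‖` factors out. -/
theorem inner_add_pos_of_norm_lt {p q h₁ h₂ : X} {s lam η : ℝ} (hs : 0 < s) (hp : ‖p‖ = 1)
    (hlam : 1 < lam) (hq : lam ≤ ‖q‖) (hh₁ : ‖h₁‖ ≤ η) (hh₂ : ‖h₂‖ ≤ η) (hη : 0 < η)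
    (hη1 : η ≤ 1) (hηs : (s + 2) * η < s * (lam - 1)) :
    0 < inner ℝ (s • (p + q) + h₁) (q - p + h₂) := by
  set t := ‖q‖ with ht
  have e1 : inner ℝ (s • (p + q) + h₁) (q - p + h₂) =
      s * (t ^ 2 - 1) + s * inner ℝ (p + q) h₂ + inner ℝ h₁ (q - p) + inner ℝ h₁ h₂ := by
    have h1 : inner ℝ (p + q) (q - p) = t ^ 2 - 1 := by
      rw [inner_add_left, inner_sub_right, inner_sub_right, real_inner_self_eq_norm_sq,
        real_inner_self_eq_norm_sq, hp, real_inner_comm p]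
      ring
    rw [inner_add_left, inner_add_right, inner_add_right, real_inner_smul_left,
      real_inner_smul_left, h1]
    ring
  have e2 : -((1 + t) * η) ≤ inner ℝ (p + q) h₂ := by
    have h1 := (abs_le.1 (abs_real_inner_le_norm (p + q) h₂)).1
    have h2 : ‖p + q‖ ≤ 1 + t := hp ▸ norm_add_le _ _
    have h3 : ‖p + q‖ * ‖h₂‖ ≤ (1 + t) * η := by gcongr
    linarith
  have e3 : -((1 + t) * η) ≤ inner ℝ h₁ (q - p) := by
    have h1 := (abs_le.1 (abs_real_inner_le_norm h₁ (q - p))).1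
    have h2 : ‖q - p‖ ≤ t + 1 := hp ▸ norm_sub_le _ _
    have h3 : ‖h₁‖ * ‖q - p‖ ≤ η * (t + 1) := by gcongr
    linarith
  have e4 : -(η * η) ≤ inner ℝ h₁ h₂ := by
    have h1 := (abs_le.1 (abs_real_inner_le_norm h₁ h₂)).1
    have h3 : ‖h₁‖ * ‖h₂‖ ≤ η * η := by gcongr
    linarith
  have e5 : 0 < (1 + t) * (s * (t - 1) - (s + 2) * η) := by
    refine mul_pos (by linarith) ?_
    have : s * (lam - 1) ≤ s * (t - 1) := by gcongr
    linarith
  have e6 := mul_le_mul_of_nonneg_left e2 hs.le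
  have e7 : η * η ≤ (1 + t) * η := by
    gcongr; linarith
  rw [e1]
  linarith

theorem RegularCoderivativePSD.exists_approx_min [CompleteSpace X] {T : X → Set X}
    (h : RegularCoderivativePSD T) {C : Set (WithLp 2 (X × X))} (hCΩ : C ⊆ gphL2 T)
    (hC : IsClosed C) {R : ℝ} (hR : ∀ x ∈ C, ‖x‖ ≤ R) {f : WithLp 2 (X × X) → ℝ}
    (hf : ContinuousOn f C) {m : ℝ} (hm : ∀ x ∈ C, m ≤ f x) {x₀ : WithLp 2 (X × X)}
    (hx₀ : x₀ ∈ C) {η : ℝ} (hη : 0 < η) :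
    ∃ x ∈ C, ∃ h₁ h₂ : X, ‖h₁‖ ≤ η ∧ ‖h₂‖ ≤ η ∧ f x ≤ f x₀ + η ∧
      (C ∈ 𝓝[gphL2 T] x → ∀ g, HasGradientAt f g x →
        inner ℝ (g.fst + h₁) (g.snd + h₂) ≤ 0) := by
  obtain ⟨x, hx, k, hk, hfx, hN⟩ := exists_approx_min_normal hCΩ hC hR hf hm hx₀ hη
  refine ⟨x, hx, k.fst, k.snd, (WithLp.norm_fst_le X k).trans hk, (WithLp.norm_snd_le X k).trans hk,
    hfx, fun hn g hg => ?_⟩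
  have := h.inner_nonpos (hN hn g hg)
  rwa [WithLp.neg_fst, WithLp.neg_snd, inner_neg_neg] at this

end Graph

/-! ### From hypomonotonicity to local monotonicity. -/

section LocalMonotonicity

variable {X : Type*} [NormedAddCommGroup X] [InnerProductSpace ℝ X] [CompleteSpace X]

theorem hasGradientAt_linear_add_radial (p u v : X) (s lam β d : ℝ) (n : ℕ)
    {x : WithLp 2 (X × X)} (hx : s • (x.fst - u) + (x.snd - v) ≠ 0) :
    HasGradientAt (fun x : WithLp 2 (X × X) => inner ℝ p (s • (x.fst - u) - (x.snd - v)) +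
        lam * √(‖s • (x.fst - u) + (x.snd - v)‖ ^ 2) +
        β * (‖s • (x.fst - u) + (x.snd - v)‖ ^ 2 / d ^ 2) ^ n)
      (WithLp.toLp 2
        (s • (p + (lam / ‖s • (x.fst - u) + (x.snd - v)‖ +
            β * (n * (‖s • (x.fst - u) + (x.snd - v)‖ ^ 2 / d ^ 2) ^ (n - 1) * (2 / d ^ 2))) •
            (s • (x.fst - u) + (x.snd - v))),
          (lam / ‖s • (x.fst - u) + (x.snd - v)‖ +
            β * (n * (‖s • (x.fst - u) + (x.snd - v)‖ ^ 2 / d ^ 2) ^ (n - 1) * (2 / d ^ 2))) •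
            (s • (x.fst - u) + (x.snd - v)) - p)) x := by
  have hfst := (WithLp.fstL 2 ℝ X X).hasFDerivAt (x := x)
  have hsnd := (WithLp.sndL 2 ℝ X X).hasFDerivAt (x := x)
  have hA : HasFDerivAt (fun x : WithLp 2 (X × X) => s • (x.fst - u) + (x.snd - v)) _ x :=
    ((hfst.sub_const u).const_smul s).add (hsnd.sub_const v)
  have hB : HasFDerivAt (fun x : WithLp 2 (X × X) => s • (x.fst - u) - (x.snd - v)) _ x :=
    ((hfst.sub_const u).const_smul s).sub (hsnd.sub_const v)
  have h1 := (innerSL ℝ p).hasFDerivAt.comp x hB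
  have h2 := (hA.norm_sq.sqrt (pow_ne_zero 2 (norm_ne_zero_iff.2 hx))).const_mul lam
  have h3 := ((hA.norm_sq.mul_const (d ^ 2)⁻¹).pow n).const_mul β
  refine HasFDerivAt.hasGradientAt_of_inner ((h1.add h2).add h3) fun y => ?_
  generalize s • (x.fst - u) + (x.snd - v) = a
  simp [Real.sqrt_sq (norm_nonneg a), inner_add_left, inner_sub_left, real_inner_smul_left]
  ring

/-- Hypomonotonicity on a closed set `K` improves to monotonicity for pairs of graph points that
are well inside `K`, by applying the variational principle in the coordinates
`s • u + v` and `s • u - v`. -/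
theorem inner_nonneg_of_hypomonotone {T : X → Set X} (hclosed : IsClosed (gph T))
    (hPSD : RegularCoderivativePSD T) {K : Set X} (hK : IsClosed K) {r s : ℝ} (hr : 0 < r)
    (hrs : r < s)
    (hhyp : ∀ u₁ ∈ K, ∀ v₁ ∈ T u₁, ∀ u₂ ∈ K, ∀ v₂ ∈ T u₂,
      -r * ‖u₁ - u₂‖ ^ 2 ≤ inner ℝ (v₁ - v₂) (u₁ - u₂))
    {u₁ v₁ u₂ v₂ : X} (hu₁ : u₁ ∈ K) (hv₁ : v₁ ∈ T u₁) (hu₂ : u₂ ∈ K) (hv₂ : v₂ ∈ T u₂)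
    (hball : Metric.closedBall u₂ (2 * ‖s • (u₁ - u₂) + (v₁ - v₂)‖ / (s - r)) ⊆ interior K) :
    0 ≤ inner ℝ (v₁ - v₂) (u₁ - u₂) := by
  by_contra! hneg
  have hs : 0 < s := hr.trans hrs
  have hsr : 0 < s - r := sub_pos.2 hrs
  let A : WithLp 2 (X × X) → X := fun x => s • (x.fst - u₂) + (x.snd - v₂)
  let B : WithLp 2 (X × X) → X := fun x => s • (x.fst - u₂) - (x.snd - v₂)
  have hAc : Continuous A := by fun_prop
  have hBc : Continuous B := by fun_prop
  set x₁ : WithLp 2 (X × X) := WithLp.toLp 2 (u₁, v₁) with hx₁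
  set d := ‖s • (u₁ - u₂) + (v₁ - v₂)‖ with hd
  have hAx₁ : ‖A x₁‖ = d := rfl
  set b := ‖B x₁‖ with hb
  set M := 1 + 2 * s / (s - r) with hM
  have hM0 : 0 < M := by positivity
  -- Since `s > r`, hypomonotonicity makes `A` control the graph near `u₂`: it bounds `B`, bounds
  -- `C`, and keeps `u` inside the ball assumed to lie in the interior of `K`.
  have hest : ∀ x ∈ gphL2 T, x.fst ∈ K → (s - r) * ‖x.fst - u₂‖ ≤ ‖A x‖ := by
    intro x hx hxK
    rcases (norm_nonneg (x.fst - u₂)).eq_or_lt with h0 | h0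
    · rw [← h0, mul_zero]; exact norm_nonneg _
    have h1 : -r * ‖x.fst - u₂‖ ^ 2 ≤ inner ℝ (x.snd - v₂) (x.fst - u₂) :=
      hhyp _ hxK _ hx _ hu₂ _ hv₂
    have h2 : inner ℝ (A x) (x.fst - u₂) ≤ ‖A x‖ * ‖x.fst - u₂‖ := real_inner_le_norm _ _
    have h3 : inner ℝ (A x) (x.fst - u₂) =
        s * ‖x.fst - u₂‖ ^ 2 + inner ℝ (x.snd - v₂) (x.fst - u₂) := by
      rw [inner_add_left, real_inner_smul_left, real_inner_self_eq_norm_sq]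
    nlinarith
  have hBM : ∀ x ∈ gphL2 T, x.fst ∈ K → ‖B x‖ ≤ M * ‖A x‖ := by
    intro x hx hxK
    have h1 : B x = (2 * s) • (x.fst - u₂) - A x := by simp only [A, B]; module
    have h2 : ‖B x‖ ≤ 2 * s * ‖x.fst - u₂‖ + ‖A x‖ := by
      rw [h1]
      refine (norm_sub_le _ _).trans ?_
      rw [norm_smul, Real.norm_of_nonneg (by positivity)]
    have h3 : ‖x.fst - u₂‖ ≤ ‖A x‖ / (s - r) := by
      rw [le_div_iff₀ hsr, mul_comm]; exact hest x hx hxK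
    calc ‖B x‖ ≤ 2 * s * ‖x.fst - u₂‖ + ‖A x‖ := h2
      _ ≤ 2 * s * (‖A x‖ / (s - r)) + ‖A x‖ := by gcongr
      _ = M * ‖A x‖ := by rw [hM]; ring
  have hbd : d < b := by
    have h1 : b ^ 2 - d ^ 2 = -(4 * s * inner ℝ (v₁ - v₂) (u₁ - u₂)) := by
      change ‖s • (u₁ - u₂) - (v₁ - v₂)‖ ^ 2 - ‖s • (u₁ - u₂) + (v₁ - v₂)‖ ^ 2 = _
      rw [norm_add_sq_real, norm_sub_sq_real, real_inner_smul_left, real_inner_comm]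
      ring
    have h2 : 0 < b ^ 2 - d ^ 2 := by rw [h1]; nlinarith
    exact lt_of_pow_lt_pow_left₀ 2 (norm_nonneg _) (by linarith)
  have hd0 : 0 < d := by
    have h1 : b ≤ M * d := hBM x₁ hv₁ hu₁
    have h2 : 0 ≤ d := norm_nonneg _
    rcases h2.eq_or_lt with h | h
    · rw [← h] at h1 hbd; linarith
    · exact h
  have hb0 : 0 < b := hd0.trans hbd
  let p : X := -(b⁻¹ • B x₁)
  have hp : ‖p‖ = 1 := by
    simp only [p]
    rw [norm_neg, norm_smul, norm_inv, norm_norm, ← hb, inv_mul_cancel₀ hb0.ne']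
  -- A slope strictly between 1 and `b / d`: small enough to keep `f x₁` negative, large enough to
  -- make the gradient's inner product positive.
  set lam := (1 + b / d) / 2 with hlam
  have hlam1 : 1 < lam := by
    have : 1 < b / d := (one_lt_div hd0).2 hbd
    linarith
  have hlamd : lam * d = (d + b) / 2 := by rw [hlam]; field_simp
  set β := (b - d) / 4 with hβ
  have hβ0 : 0 < β := by linarith
  -- The penalty equals `β` where `‖A‖ = d`, but `β * 4 ^ n` where `‖A‖ = 2 * d`; there it exceeds
  -- the worst value of the linear term, so the near-minimizer avoids that boundary.
  obtain ⟨n, hn⟩ : ∃ n : ℕ, M * (2 * d) / β < 4 ^ n :=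
    pow_unbounded_of_one_lt _ (by norm_num)
  rw [div_lt_iff₀ hβ0] at hn
  let f : WithLp 2 (X × X) → ℝ := fun x =>
    inner ℝ p (B x) + lam * √(‖A x‖ ^ 2) + β * (‖A x‖ ^ 2 / d ^ 2) ^ n
  have hfval : ∀ x, f x = inner ℝ p (B x) + lam * ‖A x‖ + β * (‖A x‖ ^ 2 / d ^ 2) ^ n := by
    intro x; simp only [f]; rw [Real.sqrt_sq (norm_nonneg _)]
  have hfc : Continuous f := by fun_prop
  have hpB : ∀ x ∈ gphL2 T, x.fst ∈ K → -(M * ‖A x‖) ≤ inner ℝ p (B x) := by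
    intro x hx hxK
    have h1 := (abs_le.1 (abs_real_inner_le_norm p (B x))).1
    rw [hp, one_mul] at h1
    linarith [hBM x hx hxK]
  have hfx₁ : f x₁ = -β := by
    have h1 : inner ℝ p (B x₁) = -b := by
      simp only [p]
      rw [inner_neg_left, real_inner_smul_left, real_inner_self_eq_norm_sq, ← hb]
      field_simp
    rw [hfval, h1, hAx₁, hlamd, div_self (by positivity), one_pow, hβ]
    ring
  let C : Set (WithLp 2 (X × X)) := gphL2 T ∩ {x | x.fst ∈ K} ∩ {x | ‖A x‖ ≤ 2 * d}
  have hC : IsClosed C := ((isClosed_gphL2 hclosed).inter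
    (hK.preimage (by fun_prop : Continuous fun x : WithLp 2 (X × X) => x.fst))).inter
    (isClosed_le (by fun_prop) continuous_const)
  have hCu : ∀ x ∈ C, ‖x.fst - u₂‖ ≤ 2 * d / (s - r) := by
    rintro x ⟨⟨hx, hxK⟩, hxA⟩
    rw [le_div_iff₀ hsr, mul_comm]; exact (hest x hx hxK).trans hxA
  have hR : ∀ x ∈ C, ‖x‖ ≤ (‖u₂‖ + 2 * d / (s - r)) +
      (‖v₂‖ + 2 * d + s * (2 * d / (s - r))) := by
    intro x hx
    have h1 : ‖x.fst‖ ≤ ‖u₂‖ + 2 * d / (s - r) := by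
      linarith [norm_le_norm_add_norm_sub' x.fst u₂, hCu x hx]
    have h2 : ‖x.snd‖ ≤ ‖v₂‖ + 2 * d + s * (2 * d / (s - r)) := by
      have h3 : x.snd = v₂ + A x - s • (x.fst - u₂) := by simp only [A]; module
      have h4 : ‖s • (x.fst - u₂)‖ ≤ s * (2 * d / (s - r)) := by
        rw [norm_smul, Real.norm_of_nonneg hs.le]; gcongr; exact hCu x hx
      rw [h3]
      have h5 := norm_sub_le (v₂ + A x) (s • (x.fst - u₂))
      have h6 := norm_add_le v₂ (A x)
      have h7 : ‖A x‖ ≤ 2 * d := hx.2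
      linarith
    have h3 : ‖x‖ ≤ ‖x.fst‖ + ‖x.snd‖ := by
      refine abs_le_of_sq_le_sq' ?_ (by positivity) |>.2
      rw [WithLp.prod_norm_sq_eq_of_L2]
      nlinarith [mul_nonneg (norm_nonneg x.fst) (norm_nonneg x.snd)]
    linarith
  have hfm : ∀ x ∈ C, -(M * (2 * d)) ≤ f x := by
    rintro x ⟨⟨hx, hxK⟩, hxA⟩
    have h1 := hpB x hx hxK
    have h2 : M * ‖A x‖ ≤ M * (2 * d) := by gcongr; exact hxA
    have h3 : 0 ≤ lam * ‖A x‖ := by positivity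
    have h4 : 0 ≤ β * (‖A x‖ ^ 2 / d ^ 2) ^ n := by positivity
    rw [hfval]; linarith
  have hx₁C : x₁ ∈ C := ⟨⟨hv₁, hu₁⟩, by
    change ‖A x₁‖ ≤ 2 * d
    rw [hAx₁]; linarith⟩
  obtain ⟨η, hη, hη1, hη2, hη3⟩ :
      ∃ η > 0, η ≤ 1 ∧ η < β ∧ (s + 2) * η < s * (lam - 1) := by
    have h0 : 0 < s * (lam - 1) := mul_pos hs (by linarith)
    refine ⟨min 1 (min (β / 2) (s * (lam - 1) / (2 * (s + 2)))), by positivity,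
      min_le_left _ _, ?_, ?_⟩
    · exact ((min_le_right _ _).trans (min_le_left _ _)).trans_lt (by linarith)
    · calc (s + 2) * min 1 (min (β / 2) (s * (lam - 1) / (2 * (s + 2))))
          ≤ (s + 2) * (s * (lam - 1) / (2 * (s + 2))) := by
            gcongr; exact (min_le_right _ _).trans (min_le_right _ _)
        _ = s * (lam - 1) / 2 := by field_simp
        _ < s * (lam - 1) := by linarith
  obtain ⟨x, hxC, h₁, h₂, hh₁, hh₂, hfx, hN⟩ := hPSD.exists_approx_min
    (fun x hx => hx.1.1) hC hR hfc.continuousOn hfm hx₁C hη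
  have hfneg : f x < 0 := by rw [hfx₁] at hfx; linarith
  have hxAlt : ‖A x‖ < 2 * d := by
    refine lt_of_le_of_ne hxC.2 fun heq => ?_
    have h1 := hpB x hxC.1.1 hxC.1.2
    rw [hfval, heq, show (2 * d) ^ 2 / d ^ 2 = 4 by field_simp; norm_num] at hfneg
    rw [heq] at h1
    have h3 : 0 ≤ lam * (2 * d) := by positivity
    linarith
  -- At `A x = 0` the bound on `B` forces `f x ≥ 0`, so a negative value avoids the only point where
  -- the norm term is not differentiable.
  have hA0 : 0 < ‖A x‖ := by
    refine lt_of_le_of_ne (norm_nonneg _) fun heq => ?_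
    have h1 := hpB x hxC.1.1 hxC.1.2
    rw [← heq, mul_zero, neg_zero] at h1
    rw [hfval, ← heq, mul_zero] at hfneg
    have h4 : 0 ≤ β * ((0 : ℝ) ^ 2 / d ^ 2) ^ n := by positivity
    linarith
  have hnhds : C ∈ 𝓝[gphL2 T] x := by
    have h1 : ∀ᶠ z in 𝓝 x, z.fst ∈ interior K :=
      (by fun_prop : Continuous fun x : WithLp 2 (X × X) => x.fst).continuousAt
        (isOpen_interior.mem_nhds (hball (by
          rw [Metric.mem_closedBall, dist_eq_norm]; exact hCu x hxC)))
    have h2 : ∀ᶠ z in 𝓝 x, ‖A z‖ < 2 * d :=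
      hAc.norm.continuousAt.eventually_lt continuousAt_const hxAlt
    rw [mem_nhdsWithin_iff_eventually]
    filter_upwards [h1, h2] with z hz1 hz2 hz
    exact ⟨⟨hz, interior_subset (s := K) hz1⟩, hz2.le⟩
  set c := lam / ‖A x‖ + β * (n * (‖A x‖ ^ 2 / d ^ 2) ^ (n - 1) * (2 / d ^ 2)) with hc
  have hgrad : HasGradientAt f (WithLp.toLp 2 (s • (p + c • A x), c • A x - p)) x :=
    hasGradientAt_linear_add_radial p u₂ v₂ s lam β d n (norm_pos_iff.1 hA0)
  have hkey : inner ℝ (s • (p + c • A x) + h₁) (c • A x - p + h₂) ≤ 0 := hN hnhds _ hgrad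
  have hlam_le : lam ≤ ‖c • A x‖ := by
    have hc0 : lam / ‖A x‖ ≤ c := by
      rw [hc]; exact le_add_of_nonneg_right (by positivity)
    have : 0 ≤ c := le_trans (by positivity) hc0
    rw [norm_smul, Real.norm_of_nonneg this]
    exact (div_le_iff₀ hA0).1 hc0
  exact hkey.not_gt (inner_add_pos_of_norm_lt hs hp hlam1 hlam_le hh₁ hh₂ hη hη1 hη3)

/-- The values of `T` may be unbounded near `x`, so `s` is chosen for each pair, growing with `‖v₁ -
v₂‖`. This keeps `2 * ‖s • (u₁ - u₂) + (v₁ - v₂)‖ / (s - r)` below `15 / 16 * ε` uniformly, so one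
radius serves all pairs. -/
theorem SemilocallyHypomonotoneAt.exists_monotone_ball {T : X → Set X}
    (hclosed : IsClosed (gph T)) (hPSD : RegularCoderivativePSD T) {x : X}
    (h : SemilocallyHypomonotoneAt T x) :
    ∃ ε > 0, ∀ u₁ ∈ Metric.ball x ε, ∀ v₁ ∈ T u₁, ∀ u₂ ∈ Metric.ball x ε, ∀ v₂ ∈ T u₂,
      0 ≤ inner ℝ (v₁ - v₂) (u₁ - u₂) := by
  obtain ⟨U, hU, r, hr, hhyp⟩ := h
  obtain ⟨ε, hε, hεU⟩ := Metric.nhds_basis_closedBall.mem_iff.1 hU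
  refine ⟨ε / 16, by positivity, fun u₁ hu₁ v₁ hv₁ u₂ hu₂ v₂ hv₂ => ?_⟩
  have hsub : Metric.ball x (ε / 16) ⊆ Metric.closedBall x ε :=
    (Metric.ball_subset_ball (by linarith)).trans Metric.ball_subset_closedBall
  have hv : 0 ≤ ‖v₁ - v₂‖ := norm_nonneg _
  set s := 2 * r + 8 * ‖v₁ - v₂‖ / ε with hs
  have hrs : r < s := by
    have : 0 ≤ 8 * ‖v₁ - v₂‖ / ε := by positivity
    linarith
  refine inner_nonneg_of_hypomonotone hclosed hPSD (Metric.isClosed_closedBall (x := x) (ε := ε))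
    hr hrs (fun u hu v hv u' hu' v' hv' => hhyp u v u' v' ⟨hv, hεU hu, trivial⟩
      ⟨hv', hεU hu', trivial⟩) (hsub hu₁) hv₁ (hsub hu₂) hv₂ ?_
  refine subset_trans ?_ Metric.ball_subset_interior_closedBall
  refine Metric.closedBall_subset_ball' ?_
  have hsε : s * ε = 2 * r * ε + 8 * ‖v₁ - v₂‖ := by rw [hs]; field_simp
  have hdu : ‖u₁ - u₂‖ ≤ ε / 8 := by
    rw [← dist_eq_norm]
    have := dist_triangle_right u₁ u₂ x
    rw [Metric.mem_ball] at hu₁ hu₂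
    linarith
  have hd : ‖s • (u₁ - u₂) + (v₁ - v₂)‖ ≤ s * (ε / 8) + ‖v₁ - v₂‖ := by
    refine (norm_add_le _ _).trans ?_
    rw [norm_smul, Real.norm_of_nonneg (by linarith)]
    gcongr
  have hsr : 0 < s - r := sub_pos.2 hrs
  have h1 : 2 * ‖s • (u₁ - u₂) + (v₁ - v₂)‖ / (s - r) < 15 / 16 * ε := by
    rw [div_lt_iff₀ hsr]
    nlinarith [mul_pos hr hε]
  rw [Metric.mem_ball] at hu₂
  linarith

end LocalMonotonicity

/-! ### From local to global monotonicity on a convex domain. -/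

section GlobalMonotonicity

variable {X : Type*} [NormedAddCommGroup X] [InnerProductSpace ℝ X]

/-- Convexity keeps the segment in the domain, so values can be picked at a subdivision finer than a
Lebesgue number. Consecutive displacements are positive multiples of `u₂ - u₁`, and the local
inequalities telescope. -/
theorem isMonotone_of_locally {T : X → Set X} (hconvex : Convex ℝ (dom T))
    (hloc : ∀ x ∈ dom T, ∃ ε > 0, ∀ u₁ ∈ Metric.ball x ε, ∀ v₁ ∈ T u₁,
      ∀ u₂ ∈ Metric.ball x ε, ∀ v₂ ∈ T u₂, 0 ≤ inner ℝ (v₁ - v₂) (u₁ - u₂)) :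
    IsMonotone T := by
  intro u₂ v₂ u₁ v₁ hv₂ hv₁
  let γ : ℝ → X := fun t => u₁ + t • (u₂ - u₁)
  have hγc : Continuous γ := by fun_prop
  have hγ : ∀ t ∈ Set.Icc (0 : ℝ) 1, γ t ∈ dom T := fun t ht =>
    hconvex.add_smul_sub_mem ⟨v₁, hv₁⟩ ⟨v₂, hv₂⟩ ht
  choose! ε hε hmono using hloc
  obtain ⟨δ, hδ, hcover⟩ := lebesgue_number_lemma_of_metric (s := Set.Icc (0 : ℝ) 1)
    (c := fun t : Set.Icc (0 : ℝ) 1 => γ ⁻¹' Metric.ball (γ t) (ε (γ t))) isCompact_Icc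
    (fun t => Metric.isOpen_ball.preimage hγc)
    (fun t ht => Set.mem_iUnion.2 ⟨⟨t, ht⟩, Metric.mem_ball_self (hε _ (hγ t ht))⟩)
  have hstep : ∀ t ∈ Set.Icc (0 : ℝ) 1, ∀ t', t < t' → t' < t + δ →
      ∀ v ∈ T (γ t), ∀ v' ∈ T (γ t'), 0 ≤ inner ℝ (v' - v) (u₂ - u₁) := by
    intro t ht t' htt' ht' v hv v' hv'
    obtain ⟨i, hi⟩ := hcover t ht
    have h1 := hmono _ (hγ i i.2) (γ t') (hi (by
      rw [Metric.mem_ball, Real.dist_eq, abs_of_pos (sub_pos.2 htt')]; linarith)) v' hv'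
      (γ t) (hi (Metric.mem_ball_self hδ)) v hv
    have h2 : γ t' - γ t = (t' - t) • (u₂ - u₁) := by simp only [γ]; module
    rw [h2, inner_smul_right] at h1
    exact nonneg_of_mul_nonneg_right h1 (sub_pos.2 htt')
  obtain ⟨N, hN⟩ := exists_nat_one_div_lt hδ
  have hN0 : (0 : ℝ) < N + 1 := by positivity
  have hstep' : ∀ i : ℕ, i ≤ N → ∀ v ∈ T (γ (i / (N + 1))), ∀ v' ∈ T (γ ((i + 1 : ℕ) / (N + 1))),
      0 ≤ inner ℝ (v' - v) (u₂ - u₁) := by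
    intro i hi
    have hi' : (i : ℝ) ≤ N := by exact_mod_cast hi
    have he : ((i + 1 : ℕ) : ℝ) / (N + 1) = i / (N + 1) + 1 / (N + 1) := by push_cast; ring
    refine hstep _ ⟨by positivity, ?_⟩ _ ?_ ?_
    · rw [div_le_one hN0]; linarith
    · rw [he]; exact lt_add_of_pos_right _ (by positivity)
    · rw [he]; gcongr
  have hind : ∀ i : ℕ, i ≤ N → ∀ v ∈ T (γ ((i + 1 : ℕ) / (N + 1))),
      0 ≤ inner ℝ (v - v₁) (u₂ - u₁) := by
    intro i
    induction i with
    | zero =>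
      intro _ v hv
      exact hstep' 0 (Nat.zero_le _) v₁ (by simpa [γ, gph] using hv₁) v hv
    | succ i ih =>
      intro hi v hv
      have hi' : ((i + 1 : ℕ) : ℝ) ≤ N := by exact_mod_cast hi
      obtain ⟨w, hw⟩ := hγ ((i + 1 : ℕ) / (N + 1))
        ⟨by positivity, by rw [div_le_one hN0]; linarith⟩
      have h1 := ih (by omega) w hw
      have h2 := hstep' (i + 1) hi w hw v hv
      rw [← sub_add_sub_cancel v w v₁, inner_add_left]
      exact add_nonneg h2 h1
  refine hind N le_rfl v₂ ?_
  have : γ ((N + 1 : ℕ) / (N + 1)) = u₂ := by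
    simp only [γ]
    rw [show ((N + 1 : ℕ) : ℝ) / (N + 1) = 1 by push_cast; field_simp]
    module
  rw [this]; exact hv₂

end GlobalMonotonicity

/-! ### Minty's theorem in both directions. -/

section Minty

variable {X : Type*} [NormedAddCommGroup X] [InnerProductSpace ℝ X]

/-- A point of a monotone extension shares its sum `u + v` with some point of `gph T`; the
differences are then opposite, so monotonicity makes them vanish. -/
theorem IsMonotone.isMaximalMonotone_of_surjective {T : X → Set X} (hT : IsMonotone T)
    (hsurj : ∀ y, ∃ u v, (u, v) ∈ gph T ∧ u + v = y) : IsMaximalMonotone T := by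
  refine ⟨hT, fun S hS hTS => hTS.antisymm ?_⟩
  rintro ⟨u, v⟩ huv
  obtain ⟨u', v', h', heq⟩ := hsurj (u + v)
  have h1 := hS u v u' v' huv (hTS h')
  have h2 : v - v' = -(u - u') := by
    rw [neg_sub, sub_eq_sub_iff_add_eq_add, add_comm v, ← heq]
  rw [h2, inner_neg_left, real_inner_self_eq_norm_sq] at h1
  have h3 : u - u' = 0 := by
    rw [← norm_eq_zero, ← sq_eq_zero_iff]
    nlinarith [sq_nonneg ‖u - u'‖]
  have hu : u = u' := sub_eq_zero.1 h3
  rw [h3, neg_zero, sub_eq_zero] at h2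
  rwa [hu, h2]

theorem IsMaximalMonotone.mem_gph {T : X → Set X} (hT : IsMaximalMonotone T) {a b : X}
    (h : ∀ u v, (u, v) ∈ gph T → 0 ≤ inner ℝ (b - v) (a - u)) : (a, b) ∈ gph T := by
  let S : X → Set X := fun u => {v | (u, v) ∈ gph T ∨ (u, v) = (a, b)}
  have hS : IsMonotone S := by
    rintro u₁ v₁ u₂ v₂ (h₁ | h₁) (h₂ | h₂)
    · exact hT.1 _ _ _ _ h₁ h₂
    · obtain ⟨rfl, rfl⟩ := Prod.mk.inj h₂
      have := h _ _ h₁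
      rwa [← inner_neg_neg, neg_sub, neg_sub] at this
    · obtain ⟨rfl, rfl⟩ := Prod.mk.inj h₁
      exact h _ _ h₂
    · obtain ⟨rfl, rfl⟩ := Prod.mk.inj h₁
      obtain ⟨rfl, rfl⟩ := Prod.mk.inj h₂
      simp
  rw [hT.2 S hS fun p hp => Or.inl hp]
  exact Or.inr rfl

variable [CompleteSpace X]

/-- A strongly convex function `t + ‖p‖² / 2`, bounded below, attains its minimum on a closed
midpoint-convex set of a Hilbert space times the line. -/
theorem exists_min_add_half_norm_sq {E : Type*} [NormedAddCommGroup E] [InnerProductSpace ℝ E]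
    [CompleteSpace E] {K : Set (E × ℝ)} (hK : IsClosed K) (hconv : Convex ℝ K)
    (hne : K.Nonempty) (hbdd : ∀ k ∈ K, 0 ≤ k.2 + ‖k.1‖ ^ 2 / 2) :
    ∃ k ∈ K, ∀ k' ∈ K, k.2 + ‖k.1‖ ^ 2 / 2 ≤ k'.2 + ‖k'.1‖ ^ 2 / 2 := by
  let Φ : E × ℝ → ℝ := fun k => k.2 + ‖k.1‖ ^ 2 / 2
  have hΦc : Continuous Φ := by fun_prop
  have hb : BddBelow (Φ '' K) := ⟨0, by rintro _ ⟨k, hk, rfl⟩; exact hbdd k hk⟩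
  set ι := sInf (Φ '' K) with hι
  have hle : ∀ k ∈ K, ι ≤ Φ k := fun k hk => csInf_le hb (Set.mem_image_of_mem Φ hk)
  have hseq : ∀ n : ℕ, ∃ k ∈ K, Φ k ≤ ι + (1 / 4) ^ n := by
    intro n
    obtain ⟨_, ⟨k, hk, rfl⟩, hlt⟩ := exists_lt_of_csInf_lt (hne.image Φ)
      (lt_add_of_pos_right ι (by positivity : (0 : ℝ) < (1 / 4) ^ n))
    exact ⟨k, hk, hlt.le⟩
  choose k hkK hk using hseq
  have hdist : ∀ n, dist (k n).1 (k (n + 1)).1 ≤ 4 * (1 / 2) ^ n := by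
    intro n
    have h1 := hle _ (hconv (hkK n) (hkK (n + 1)) (by norm_num : (0 : ℝ) ≤ 1 / 2)
      (by norm_num : (0 : ℝ) ≤ 1 / 2) (by norm_num))
    have h2 := hk n
    have h3 := hk (n + 1)
    have h4 : (0 : ℝ) < (1 / 4) ^ n := by positivity
    rw [pow_succ] at h3
    simp only [Φ, Prod.fst_add, Prod.snd_add, Prod.smul_fst, Prod.smul_snd, smul_eq_mul]
      at h1 h2 h3
    have h5 : ‖(1 / 2 : ℝ) • (k n).1 + (1 / 2 : ℝ) • (k (n + 1)).1‖ ^ 2 =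
        (‖(k n).1‖ ^ 2 + ‖(k (n + 1)).1‖ ^ 2) / 2 - ‖(k n).1 - (k (n + 1)).1‖ ^ 2 / 4 := by
      rw [← smul_add, norm_smul, mul_pow, norm_add_sq_real, norm_sub_sq_real]
      norm_num
      ring
    rw [h5] at h1
    rw [dist_eq_norm]
    refine abs_le_of_sq_le_sq' ?_ (by positivity) |>.2
    have h6 : (4 * (1 / 2 : ℝ) ^ n) ^ 2 = 16 * (1 / 4) ^ n := by
      rw [mul_pow, ← pow_mul, mul_comm n, pow_mul]; norm_num
    rw [h6]
    linarith
  obtain ⟨p, hp⟩ := cauchySeq_tendsto_of_complete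
    (cauchySeq_of_le_geometric (1 / 2) 4 (by norm_num) hdist)
  have hΦlim : Tendsto (fun n => Φ (k n)) atTop (𝓝 ι) := by
    have h1 : Tendsto (fun n : ℕ => ι + (1 / 4 : ℝ) ^ n) atTop (𝓝 ι) := by
      simpa using (tendsto_pow_atTop_nhds_zero_of_lt_one (r := (1 / 4 : ℝ)) (by norm_num)
        (by norm_num)).const_add ι
    exact tendsto_of_tendsto_of_tendsto_of_le_of_le tendsto_const_nhds h1
      (fun n => hle _ (hkK n)) hk
  have hlim : Tendsto k atTop (𝓝 (p, ι - ‖p‖ ^ 2 / 2)) := by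
    have h2 : Tendsto (fun n => (k n).2) atTop (𝓝 (ι - ‖p‖ ^ 2 / 2)) := by
      refine (hΦlim.sub ((hp.norm.pow 2).div_const 2)).congr fun n => ?_
      simp [Φ]
    exact hp.prodMk_nhds h2
  refine ⟨_, hK.mem_of_tendsto hlim (Eventually.of_forall hkK), fun k' hk' => ?_⟩
  simpa using hle k' hk'

/-- Minty's theorem, by minimizing the Fitzpatrick function plus half the squared norm. -/
theorem IsMaximalMonotone.surjective {T : X → Set X} (hT : IsMaximalMonotone T)
    (hne : (dom T).Nonempty) (y : X) : ∃ u v, (u, v) ∈ gph T ∧ u + v = y := by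
  obtain ⟨u₀, v₀, h₀⟩ := hne
  -- The epigraph of the Fitzpatrick function of `T - y`.
  let K : Set (WithLp 2 (X × X) × ℝ) := {k | ∀ u v, (u, v) ∈ gph T →
    inner ℝ k.1.fst (v - y) + inner ℝ u k.1.snd - inner ℝ u (v - y) ≤ k.2}
  have hK : IsClosed K := by
    simp only [K, Set.ofPred_forall]
    refine isClosed_iInter fun u => isClosed_iInter fun v => isClosed_iInter fun _ => ?_
    exact isClosed_le (by fun_prop) (by fun_prop)
  have hconv : Convex ℝ K := by
    intro k hk k' hk' a b ha hb hab u v huv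
    have h1 := mul_le_mul_of_nonneg_left (hk u v huv) ha
    have h2 := mul_le_mul_of_nonneg_left (hk' u v huv) hb
    simp only [Prod.fst_add, Prod.snd_add, Prod.smul_fst, Prod.smul_snd, WithLp.add_fst,
      WithLp.add_snd, WithLp.smul_fst, WithLp.smul_snd, inner_add_left, inner_add_right,
      real_inner_smul_left, real_inner_smul_right, smul_eq_mul]
    have h3 : inner ℝ u (v - y) = a * inner ℝ u (v - y) + b * inner ℝ u (v - y) := by
      rw [← add_mul, hab, one_mul]
    linarith
  have hgK : ∀ u v, (u, v) ∈ gph T →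
      ((WithLp.toLp 2 (u, v - y), inner ℝ u (v - y)) : WithLp 2 (X × X) × ℝ) ∈ K := by
    intro u v huv u' v' huv'
    have h1 := hT.1 _ _ _ _ huv huv'
    have h2 : v - v' = (v - y) - (v' - y) := by abel
    rw [h2, inner_sub_left, inner_sub_right, inner_sub_right, real_inner_comm u,
      real_inner_comm u', real_inner_comm u, real_inner_comm u'] at h1
    change inner ℝ u (v' - y) + inner ℝ u' (v - y) - inner ℝ u' (v' - y) ≤ inner ℝ u (v - y)
    linarith
  have hFitz : ∀ k ∈ K, inner ℝ k.1.fst k.1.snd ≤ k.2 := by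
    intro k hk
    by_contra! hlt
    have h1 : ∀ u v, (u, v) ∈ gph T → 0 < inner ℝ (k.1.snd + y - v) (k.1.fst - u) := by
      intro u v huv
      have h2 := hk u v huv
      rw [show k.1.snd + y - v = k.1.snd - (v - y) by abel, inner_sub_left, inner_sub_right,
        inner_sub_right, real_inner_comm k.1.fst, real_inner_comm u, real_inner_comm k.1.fst,
        real_inner_comm u]
      linarith
    have h2 := h1 _ _ (hT.mem_gph fun u v huv => (h1 u v huv).le)
    simp at h2
  obtain ⟨k, hk, hmin⟩ := exists_min_add_half_norm_sq hK hconv ⟨_, hgK u₀ v₀ h₀⟩ (by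
    intro k hk
    have h1 := hFitz k hk
    have h2 := norm_add_sq_real k.1.fst k.1.snd
    rw [WithLp.prod_norm_sq_eq_of_L2]
    nlinarith [sq_nonneg ‖k.1.fst + k.1.snd‖])
  -- First-order optimality of the minimizer, from the difference quotient along the segment to `k'`
  -- as `θ → 0`.
  have hvar : ∀ k' ∈ K, 0 ≤ k'.2 - k.2 + inner ℝ k.1 (k'.1 - k.1) := by
    intro k' hk'
    have hθ : ∀ θ ∈ Set.Ioc (0 : ℝ) 1,
        0 ≤ k'.2 - k.2 + inner ℝ k.1 (k'.1 - k.1) + θ * (‖k'.1 - k.1‖ ^ 2 / 2) := by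
      intro θ hθ
      have h1 := hmin _ (hconv.add_smul_sub_mem hk hk' ⟨hθ.1.le, hθ.2⟩)
      simp only [Prod.fst_add, Prod.snd_add, Prod.smul_fst, Prod.smul_snd, Prod.fst_sub,
        Prod.snd_sub, smul_eq_mul] at h1
      rw [norm_add_sq_real, real_inner_smul_right, norm_smul, mul_pow, Real.norm_eq_abs,
        sq_abs] at h1
      refine nonneg_of_mul_nonneg_right (a := θ) ?_ hθ.1
      linarith
    have hlim : Tendsto (fun θ : ℝ => k'.2 - k.2 + inner ℝ k.1 (k'.1 - k.1) +
        θ * (‖k'.1 - k.1‖ ^ 2 / 2)) (𝓝[>] 0) (𝓝 (k'.2 - k.2 + inner ℝ k.1 (k'.1 - k.1))) := by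
      refine Tendsto.mono_left ?_ nhdsWithin_le_nhds
      have : Continuous fun θ : ℝ => k'.2 - k.2 + inner ℝ k.1 (k'.1 - k.1) +
        θ * (‖k'.1 - k.1‖ ^ 2 / 2) := by fun_prop
      simpa using this.tendsto 0
    refine ge_of_tendsto hlim ?_
    filter_upwards [Ioc_mem_nhdsGT zero_lt_one] with θ h using hθ θ h
  set a := k.1.fst with ha
  set b := k.1.snd with hb
  -- This is used twice: nonnegativity places `(-b, -a + y)` in the graph, and then that very point
  -- as `(u, v)` gives `a + b = 0`.
  have hkey : ∀ u v, (u, v) ∈ gph T → ‖a + b‖ ^ 2 ≤ inner ℝ (-a + y - v) (-b - u) := by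
    intro u v huv
    have h1 := hvar _ (hgK u v huv)
    have h2 := hFitz k hk
    rw [inner_sub_right k.1, real_inner_self_eq_norm_sq, WithLp.prod_norm_sq_eq_of_L2,
      WithLp.prod_inner_apply] at h1
    change 0 ≤ inner ℝ u (v - y) - k.2 + (inner ℝ a u + inner ℝ b (v - y) -
      (‖a‖ ^ 2 + ‖b‖ ^ 2)) at h1
    rw [← ha, ← hb] at h2
    rw [norm_add_sq_real, show -a + y - v = -(a + (v - y)) by abel,
      show -b - u = -(b + u) by abel, inner_neg_neg, inner_add_left, inner_add_right,
      inner_add_right, real_inner_comm b (v - y), real_inner_comm u (v - y)]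
    linarith
  have hmem : (-b, -a + y) ∈ gph T :=
    hT.mem_gph fun u v huv => (sq_nonneg _).trans (hkey u v huv)
  refine ⟨_, _, hmem, ?_⟩
  have h1 := hkey _ _ hmem
  rw [sub_self, inner_zero_left] at h1
  have h2 : a + b = 0 := by
    rw [← norm_eq_zero, ← sq_eq_zero_iff]
    exact le_antisymm h1 (sq_nonneg _)
  rw [show -b + (-a + y) = y - (a + b) by abel, h2, sub_zero]

end Minty

/-! ### Surjectivity from the coderivative condition, and its converse. -/

section MaximalMonotonicity

variable {X : Type*} [NormedAddCommGroup X] [InnerProductSpace ℝ X]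

/-- The cross term of the expanded square is twice the monotonicity product. Hence graph points are
controlled by their sums. -/
theorem IsMonotone.norm_sq_add_norm_sq_le {T : X → Set X} (hT : IsMonotone T) {u₁ v₁ u₂ v₂ : X}
    (h₁ : (u₁, v₁) ∈ gph T) (h₂ : (u₂, v₂) ∈ gph T) :
    ‖u₁ - u₂‖ ^ 2 + ‖v₁ - v₂‖ ^ 2 ≤ ‖(u₁ + v₁) - (u₂ + v₂)‖ ^ 2 := by
  have h := hT _ _ _ _ h₁ h₂
  rw [show (u₁ + v₁) - (u₂ + v₂) = (v₁ - v₂) + (u₁ - u₂) by abel, norm_add_sq_real]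
  linarith

theorem IsMonotone.norm_sub_le_norm_add_sub {T : X → Set X} (hT : IsMonotone T)
    {x x' : WithLp 2 (X × X)}
    (h : x ∈ gphL2 T) (h' : x' ∈ gphL2 T) :
    ‖x - x'‖ ≤ ‖(x.fst + x.snd) - (x'.fst + x'.snd)‖ := by
  refine abs_le_of_sq_le_sq' ?_ (norm_nonneg _) |>.2
  rw [WithLp.prod_norm_sq_eq_of_L2]
  exact hT.norm_sq_add_norm_sq_le h h'

theorem IsMonotone.semilocallyHypomonotoneOn {T : X → Set X} (hT : IsMonotone T) (Ω : Set X) :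
    SemilocallyHypomonotoneOn T Ω := fun x _ =>
  ⟨Set.univ, univ_mem, 1, one_pos, fun u₁ v₁ u₂ v₂ h₁ h₂ => by
    nlinarith [hT u₁ v₁ u₂ v₂ h₁.1 h₂.1, sq_nonneg ‖u₁ - u₂‖]⟩

variable [CompleteSpace X]

/-- Both partial gradients of `‖u + v - y‖ ^ 2` equal `2 • e` with `e = u + v - y`; the sign
condition up to errors `η` then bounds `‖e‖`. Taking `η < 1` keeps the near-minimizer off the
boundary of the sublevel set. -/
theorem IsMonotone.exists_add_near {T : X → Set X} (hT : IsMonotone T)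
    (hclosed : IsClosed (gph T)) (hPSD : RegularCoderivativePSD T) (hne : (dom T).Nonempty)
    (y : X) {η : ℝ} (hη : 0 < η) (hη1 : η < 1) :
    ∃ x ∈ gphL2 T, ‖x.fst + x.snd - y‖ ≤ 2 * η := by
  obtain ⟨u₀, v₀, h₀⟩ := hne
  let f : WithLp 2 (X × X) → ℝ := fun x => ‖x.fst + x.snd - y‖ ^ 2
  have hfc : Continuous f := by fun_prop
  set x₀ : WithLp 2 (X × X) := WithLp.toLp 2 (u₀, v₀)
  let C : Set (WithLp 2 (X × X)) := gphL2 T ∩ {x | f x ≤ f x₀ + 1}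
  have hC : IsClosed C := (isClosed_gphL2 hclosed).inter (isClosed_le hfc continuous_const)
  have hR : ∀ x ∈ C, ‖x‖ ≤ ‖x₀‖ + (√(f x₀ + 1) + ‖x₀.fst + x₀.snd - y‖) := by
    rintro x ⟨hx, hfx⟩
    have h1 := hT.norm_sub_le_norm_add_sub hx (show x₀ ∈ gphL2 T from h₀)
    have h2 : ‖x.fst + x.snd - y‖ ≤ √(f x₀ + 1) := Real.le_sqrt_of_sq_le hfx
    have h3 := norm_sub_le (x.fst + x.snd - y) (x₀.fst + x₀.snd - y)
    rw [sub_sub_sub_cancel_right] at h3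
    linarith [norm_le_norm_add_norm_sub' x x₀]
  obtain ⟨x, hxC, h₁, h₂, hh₁, hh₂, hfx, hN⟩ := hPSD.exists_approx_min
    (fun x hx => hx.1) hC hR hfc.continuousOn (m := 0) (fun x _ => sq_nonneg _)
    (x₀ := x₀) ⟨h₀, by change f x₀ ≤ f x₀ + 1; linarith⟩ hη
  refine ⟨x, hxC.1, ?_⟩
  have hnhds : C ∈ 𝓝[gphL2 T] x := by
    have h2 : ∀ᶠ z in 𝓝 x, f z < f x₀ + 1 :=
      hfc.continuousAt.eventually_lt continuousAt_const (by linarith)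
    rw [mem_nhdsWithin_iff_eventually]
    filter_upwards [h2] with z hz1 hz
    exact ⟨hz, hz1.le⟩
  set e := x.fst + x.snd - y with he
  have hgrad : HasGradientAt f (WithLp.toLp 2 ((2 : ℝ) • e, (2 : ℝ) • e)) x := by
    have hA : HasFDerivAt (fun x : WithLp 2 (X × X) => x.fst + x.snd - y) _ x :=
      (((WithLp.fstL 2 ℝ X X).hasFDerivAt (x := x)).add
        (WithLp.sndL 2 ℝ X X).hasFDerivAt).sub_const y
    refine HasFDerivAt.hasGradientAt_of_inner hA.norm_sq fun z => ?_
    rw [← he]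
    simp [real_inner_smul_left]
  have hkey : inner ℝ ((2 : ℝ) • e + h₁) ((2 : ℝ) • e + h₂) ≤ 0 := hN hnhds _ hgrad
  rw [inner_add_left, inner_add_right, inner_add_right, real_inner_smul_left,
    real_inner_smul_right, real_inner_smul_left, real_inner_smul_right,
    real_inner_self_eq_norm_sq] at hkey
  have e2 : -(‖e‖ * η) ≤ inner ℝ e h₂ := by
    have h1 := (abs_le.1 (abs_real_inner_le_norm e h₂)).1
    have h3 : ‖e‖ * ‖h₂‖ ≤ ‖e‖ * η := by gcongr
    linarith
  have e3 : -(η * ‖e‖) ≤ inner ℝ h₁ e := by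
    have h1 := (abs_le.1 (abs_real_inner_le_norm h₁ e)).1
    have h3 : ‖h₁‖ * ‖e‖ ≤ η * ‖e‖ := by gcongr
    linarith
  have e4 : -(η * η) ≤ inner ℝ h₁ h₂ := by
    have h1 := (abs_le.1 (abs_real_inner_le_norm h₁ h₂)).1
    have h3 : ‖h₁‖ * ‖h₂‖ ≤ η * η := by gcongr
    linarith
  by_contra! hlt
  nlinarith [norm_nonneg e]

theorem IsMonotone.surjective_of_regularCoderivativePSD {T : X → Set X} (hT : IsMonotone T)
    (hclosed : IsClosed (gph T)) (hPSD : RegularCoderivativePSD T) (hne : (dom T).Nonempty)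
    (y : X) : ∃ u v, (u, v) ∈ gph T ∧ u + v = y := by
  have hseq : ∀ n : ℕ, ∃ x ∈ gphL2 T, ‖x.fst + x.snd - y‖ ≤ 2 * ((1 / 2) * (1 / 2) ^ n) :=
    fun n => hT.exists_add_near hclosed hPSD hne y (by positivity) (by
      rw [← pow_succ']; exact pow_lt_one₀ (by norm_num) (by norm_num) (Nat.succ_ne_zero n))
  choose x hx hxy using hseq
  have hdist : ∀ n, dist (x n) (x (n + 1)) ≤ 2 * (1 / 2) ^ n := by
    intro n
    rw [dist_eq_norm]
    refine (hT.norm_sub_le_norm_add_sub (hx n) (hx (n + 1))).trans ?_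
    rw [← sub_sub_sub_cancel_right _ _ y]
    refine (norm_sub_le _ _).trans ?_
    have h1 := hxy n
    have h2 := hxy (n + 1)
    rw [pow_succ] at h2
    have h3 : (0 : ℝ) < (1 / 2) ^ n := by positivity
    linarith
  obtain ⟨z, hz⟩ := cauchySeq_tendsto_of_complete
    (cauchySeq_of_le_geometric (1 / 2) 2 (by norm_num) hdist)
  refine ⟨z.fst, z.snd, (isClosed_gphL2 hclosed).mem_of_tendsto hz (Eventually.of_forall hx), ?_⟩
  have hc : Continuous fun x : WithLp 2 (X × X) => ‖x.fst + x.snd - y‖ := by fun_prop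
  have h0 : Tendsto (fun n : ℕ => 2 * ((1 / 2) * (1 / 2 : ℝ) ^ n)) atTop (𝓝 0) := by
    have := ((tendsto_pow_atTop_nhds_zero_of_lt_one (r := (1 / 2 : ℝ)) (by norm_num)
      (by norm_num)).const_mul (1 / 2)).const_mul 2
    rwa [mul_zero, mul_zero] at this
  have h1 := le_of_tendsto_of_tendsto' ((hc.tendsto z).comp hz) h0 hxy
  exact sub_eq_zero.1 (norm_le_zero_iff.1 h1)

theorem IsMaximalMonotone.regularCoderivativePSD {T : X → Set X} (hT : IsMaximalMonotone T) :
    RegularCoderivativePSD T := by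
  intro u v huv w z hz
  have hN := (mem_regularNormalCone_iff.1 hz).2
  set d := z - w with hd
  rcases eq_or_ne d 0 with h0 | h0
  · rw [sub_eq_zero.1 h0]; exact real_inner_self_nonneg
  have hd0 : 0 < ‖d‖ := norm_pos_iff.2 h0
  suffices h : ‖z - w‖ ≤ ‖z + w‖ by
    have h1 := pow_le_pow_left₀ (norm_nonneg _) h 2
    rw [norm_sub_sq_real, norm_add_sq_real] at h1
    linarith
  refine le_of_forall_pos_le_add fun ε hε => ?_
  have hev := hN (ε / 2) (by positivity)
  rw [eventually_nhdsWithin_iff, Metric.eventually_nhds_iff] at hev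
  obtain ⟨ρ, hρ, hball⟩ := hev
  set t := ρ / (2 * ‖d‖) with ht
  have ht0 : 0 < t := by positivity
  have htd : t * ‖d‖ < ρ := by
    have : t * ‖d‖ = ρ / 2 := by rw [ht]; field_simp
    linarith
  -- The resolvent moves by `a = u' - u` when the sum moves by `t • d`; monotonicity places `a` in
  -- the ball with diameter from 0 to `t • d`, which is `h4`.
  obtain ⟨u', v', huv', heq⟩ := hT.surjective ⟨u, v, huv⟩ (u + v + t • d)
  set x : WithLp 2 (X × X) := WithLp.toLp 2 (u, v) with hx
  set x' : WithLp 2 (X × X) := WithLp.toLp 2 (u', v') with hx'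
  have hxx : ‖x' - x‖ ≤ t * ‖d‖ := by
    refine (hT.1.norm_sub_le_norm_add_sub (T := T) (x := x') (x' := x) huv' huv).trans_eq ?_
    change ‖(u' + v') - (u + v)‖ = _
    rw [heq, add_sub_cancel_left, norm_smul, Real.norm_of_nonneg ht0.le]
  have h1 : inner ℝ z (u' - u) + inner ℝ (-w) (v' - v) ≤ ε / 2 * ‖x' - x‖ :=
    hball (by rw [dist_eq_norm]; exact hxx.trans_lt htd) huv'
  have h2 : v' - v = t • d - (u' - u) := by
    rw [eq_sub_iff_add_eq, show v' - v + (u' - u) = (u' + v') - (u + v) by abel, heq]; abel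
  have h3 := hT.1 _ _ _ _ huv' huv
  set a := u' - u with ha
  rw [h2] at h1 h3
  have h4 : ‖a - (t / 2) • d‖ ≤ t / 2 * ‖d‖ := by
    refine abs_le_of_sq_le_sq' ?_ (by positivity) |>.2
    rw [inner_sub_left, real_inner_smul_left, real_inner_self_eq_norm_sq] at h3
    rw [norm_sub_sq_real, real_inner_smul_right, norm_smul, Real.norm_of_nonneg (by positivity),
      real_inner_comm]
    linarith
  have h5 : -(‖z + w‖ * (t / 2 * ‖d‖)) ≤ inner ℝ (z + w) (a - (t / 2) • d) := by
    have := (abs_le.1 (abs_real_inner_le_norm (z + w) (a - (t / 2) • d))).1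
    have h6 : ‖z + w‖ * ‖a - (t / 2) • d‖ ≤ ‖z + w‖ * (t / 2 * ‖d‖) := by gcongr
    linarith
  have h6 : ε / 2 * ‖x' - x‖ ≤ ε / 2 * (t * ‖d‖) := by gcongr
  have h7 : ‖d‖ ^ 2 = inner ℝ z d - inner ℝ w d := by
    rw [← inner_sub_left, ← hd, real_inner_self_eq_norm_sq]
  rw [inner_sub_right, real_inner_smul_right, inner_add_left, inner_add_left] at h5
  rw [inner_neg_left, inner_sub_right w, real_inner_smul_right] at h1
  have h8 : t / 2 * ‖d‖ * ‖d‖ ≤ t / 2 * ‖d‖ * (‖z + w‖ + ε) := by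
    have : t / 2 * ‖d‖ ^ 2 = t / 2 * inner ℝ z d - t / 2 * inner ℝ w d := by rw [h7]; ring
    linarith
  exact le_of_mul_le_mul_left h8 (by positivity)

end MaximalMonotonicity

end SetValued

/-- A proper set-valued mapping `T` of a real Hilbert space `X` with closed graph and convex
domain is maximal monotone if and only if it is semilocally hypomonotone on `X` and satisfies
the regular coderivative positive-semidefiniteness condition. -/
theorem theorem3p5 {X : Type*} [NormedAddCommGroup X] [InnerProductSpace ℝ X] [CompleteSpace X]
    (T : X → Set X) (hproper : (SetValued.dom T).Nonempty)
    (hclosed : IsClosed (SetValued.gph T)) (hconvex : Convex ℝ (SetValued.dom T)) :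
    SetValued.IsMaximalMonotone T ↔
      SetValued.SemilocallyHypomonotoneOn T Set.univ ∧ SetValued.RegularCoderivativePSD T := by
  refine ⟨fun h => ⟨h.1.semilocallyHypomonotoneOn _, h.regularCoderivativePSD⟩, ?_⟩
  rintro ⟨hhypo, hPSD⟩
  have hmono : SetValued.IsMonotone T := SetValued.isMonotone_of_locally hconvex fun x hx =>
    (hhypo x ⟨trivial, hx⟩).exists_monotone_ball hclosed hPSD
  exact hmono.isMaximalMonotone_of_surjective
    (hmono.surjective_of_regularCoderivativePSD hclosed hPSD hproper)
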